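/- A multiring is a commutative monoid $(A,\cdot,1)$ with an element $0$, a map $-\colon A\to A$ and a multivalued sum assigning to $a,b\in A$ a non-empty set $a+b\subseteq A$ such that: $a\in b+c$ implies $c\in -b+a$ and $b\in a+(-c)$; $a\in b+0$ iff $a=b$; the sum is associative (if $x\in g+c$ with $g\in a+b$, there is $h\in b+c$ with $x\in a+h$) and commutative; $a\cdot 0=0$; and $a\in b+c$ implies $ad\in bd+cd$. A hyperring is a multiring in which $x\in bd+cd$ implies $x=ad$ for some $a\in b+c$. A von Neumann hyperring is a hyperring in which for every $a$ there is $b$ with $a=a^2b$. Morphisms of multirings preserve $0$, $1$, $-$, products, and the relation $a\in b+c$; an isomorphism is a morphism with a two-sided inverse morphism. A proper preorder of $A$ is a set $T\subseteq A$ with $a^2\in T$ for all $a\in A$, $T\cdot T\subseteq T$, $T+T\subseteq T$ and $-1\notin T$. Let $\mathbf 3=\{-1,0,1\}$ be the multiring with the usual product and $0+x=\{x\}$, $1+1=\{1\}$, $(-1)+(-1)=\{-1\}$, $1+(-1)=\{-1,0,1\}$, and let $\mathrm{sper}_T(A)$ be the set of morphisms $\sigma\colon A\to\mathbf 3$ with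 $\sigma(T)\subseteq\{0,1\}$. Define $Q_T(A)=\{\hat a : a\in A\}$, where $\hat a\colon \mathrm{sper}_T(A)\to\mathbf 3$, $\hat a(\sigma)=\sigma(a)$, with $\hat a\hat b=\widehat{ab}$, $-\hat a=\widehat{-a}$, constants $\hat 0,\hat 1$, and $\hat a\in\hat b+\hat c$ iff there are $a',b',c'\in A$ with $\hat{a'}=\hat a$, $\hat{b'}=\hat b$, $\hat{c'}=\hat c$ and $a'\in b'+c'$; let $\pi\colon A\to Q_T(A)$, $\pi(a)=\hat a$. For a multiplicative set $S\subseteq A$, the Marshall quotient $A/_mS$ is the quotient of $A$ by the relation $a\sim b$ iff $as=bt$ for some $s,t\in S$, with the induced product, minus and constants, where $\bar a\in\bar b+\bar c$ iff $a'\in b'+c'$ for some representatives; let $\rho\colon A\to A/_mS$ be the canonical projection. **Theorem.** Let $A$ be a von Neumann hyperring, $T\subseteq A$ a proper preorder, and $S=1+T=\bigcup_{t\in T}(1+t)$. Then $Q_T(A)$ is a real reduced multiring (that is, a multiring in which $-1$ is not a sum of squares and, for all $x,y$, $x^3=x$, $x+y^2x=\{x\}$ and $x^2+y^2$ has exactly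 one element), and there is a unique isomorphism of multirings $\Phi\colon Q_T(A)\to A/_m(1+T)$ such that $\Phi(\pi(a))=\rho(a)$ for all $a\in A$. -/

import Mathlib

/-- The operations of a multiring: a commutative multiplicative monoid with constants `0`, `1`,
a unary minus and a multivalued sum `madd b c = b + c`. The laws are in `IsMultiring`. -/
class PreMultiring (A : Type*) extends CommMonoid A, Zero A, Neg A where
  /-- the multivalued sum -/
  madd : A → A → Set A

open PreMultiring (madd)

/-- Multirings. -/
class IsMultiring (A : Type*) [PreMultiring A] : Prop where
  madd_nonempty : ∀ a b : A, (madd a b).Nonempty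
  reversibility : ∀ a b c : A, a ∈ madd b c → c ∈ madd (-b) a ∧ b ∈ madd a (-c)
  mem_madd_zero : ∀ a b : A, a ∈ madd b 0 ↔ a = b
  madd_assoc : ∀ x g a b c : A, x ∈ madd g c → g ∈ madd a b → ∃ h ∈ madd b c, x ∈ madd a h
  madd_comm : ∀ a b : A, madd a b = madd b a
  mul_zero' : ∀ a : A, a * 0 = 0
  half_distrib : ∀ a b c d : A, a ∈ madd b c → a * d ∈ madd (b * d) (c * d)

/-- Hyperrings: multirings in which full distributivity holds. -/
class IsHyperring (A : Type*) [PreMultiring A] : Prop extends IsMultiring A where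
  distrib : ∀ x b c d : A, x ∈ madd (b * d) (c * d) → ∃ a ∈ madd b c, x = a * d

/-- Von Neumann (regular) hyperrings: hyperrings in which every `a` has a `b` with `a = a²b`. -/
class IsVonNeumannHyperring (A : Type*) [PreMultiring A] : Prop extends IsHyperring A where
  regular : ∀ a : A, ∃ b : A, a = a ^ 2 * b

/-- Morphisms of multirings. -/
structure MultiringHom (A B : Type*) [PreMultiring A] [PreMultiring B] where
  toFun : A → B
  map_madd' : ∀ a b c : A, a ∈ madd b c → toFun a ∈ madd (toFun b) (toFun c)
  map_mul' : ∀ a b : A, toFun (a * b) = toFun a * toFun b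
  map_zero' : toFun 0 = 0
  map_one' : toFun 1 = 1
  map_neg' : ∀ a : A, toFun (-a) = -toFun a

/-- Isomorphisms of multirings: a morphism together with a two-sided inverse morphism. -/
structure MultiringIso (A B : Type*) [PreMultiring A] [PreMultiring B] where
  hom : MultiringHom A B
  inv : MultiringHom B A
  left_inv : ∀ a : A, inv.toFun (hom.toFun a) = a
  right_inv : ∀ b : B, hom.toFun (inv.toFun b) = b

/-- The sets `ΣA²` of sums `a₁² + ⋯ + aₙ²`, `n ≥ 1`: `MultiSumSq x` says that `x` belongs to
the multivalued sum of some finite nonempty sequence of squares. -/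
inductive MultiSumSq {A : Type*} [PreMultiring A] : A → Prop
  | sq (a : A) : MultiSumSq (a ^ 2)
  | add (a s x : A) : MultiSumSq s → x ∈ madd (a ^ 2) s → MultiSumSq x

/-- Real reduced multirings: semi-real (`-1 ∉ ΣA²`), `a³ = a`, `a + b²a = {a}`, and `a² + b²` is a
singleton. -/
structure IsRealReducedMultiring (A : Type*) [PreMultiring A] : Prop extends IsMultiring A where
  semireal : ¬ MultiSumSq (-1 : A)
  pow_three : ∀ a : A, a ^ 3 = a
  madd_sq_mul : ∀ a b : A, madd a (b ^ 2 * a) = {a}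
  madd_sq_sq : ∀ a b : A, ∃! x : A, x ∈ madd (a ^ 2) (b ^ 2)

/-- The hyperfield of signs `3 = {-1, 0, 1}`: usual product,
`0 + x = {x}`, `1 + 1 = {1}`, `(-1) + (-1) = {-1}`, `1 + (-1) = {-1, 0, 1}`. -/
instance SignType.instPreMultiring : PreMultiring SignType where
  __ := (inferInstance : CommMonoid SignType)
  __ := (inferInstance : Zero SignType)
  __ := (inferInstance : Neg SignType)
  madd a b := {x | (a = 0 ∧ x = b) ∨ (b = 0 ∧ x = a) ∨ (a = b ∧ x = a) ∨
    (a ≠ 0 ∧ b = -a)}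

/-- Preorders of a multiring: `A² ⊆ T`, `T · T ⊆ T`, `T + T ⊆ T`. -/
structure IsMultiPreorder {A : Type*} [PreMultiring A] (T : Set A) : Prop where
  sq_mem : ∀ a : A, a ^ 2 ∈ T
  mul_mem : ∀ s ∈ T, ∀ t ∈ T, s * t ∈ T
  madd_subset : ∀ s ∈ T, ∀ t ∈ T, madd s t ⊆ T

/-- Proper preorders: preorders with `-1 ∉ T`. -/
structure IsProperMultiPreorder {A : Type*} [PreMultiring A] (T : Set A) : Prop
    extends IsMultiPreorder T where
  neg_one_notMem : (-1 : A) ∉ T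

section RealReducedQuotient

/-- `sper_T(A)`: the orders (morphisms to `3`) `σ` of `A` with `σ(T) ⊆ {0, 1}`. -/
def SperOver {A : Type*} [PreMultiring A] (T : Set A) : Type _ :=
  {σ : MultiringHom A SignType // ∀ t ∈ T, σ.toFun t = 0 ∨ σ.toFun t = 1}

/-- `â : sper_T(A) → 3`, `â(σ) = σ(a)`. -/
def evalHat {A : Type*} [PreMultiring A] (T : Set A) (a : A) : SperOver T → SignType :=
  fun σ => σ.1.toFun a

/-- `Q_T(A) = {â : a ∈ A}`. -/
def RealReducedQuotient {A : Type*} [PreMultiring A] (T : Set A) : Type _ :=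
  {φ : SperOver T → SignType // ∃ a : A, evalHat T a = φ}

/-- The natural projection `π : A → Q_T(A)`. -/
def RealReducedQuotient.proj {A : Type*} [PreMultiring A] (T : Set A) (a : A) :
    RealReducedQuotient T :=
  ⟨evalHat T a, a, rfl⟩

/-- The product and minus of `Q_T(A)` are pointwise, so `â · b̂` is the class of `ab` and `-â` the
class of `-a`; `â ∈ b̂ + ĉ` if and only if `a' ∈ b' + c'` for some representatives. -/
instance RealReducedQuotient.instPreMultiring {A : Type*} [PreMultiring A] (T : Set A) :
    PreMultiring (RealReducedQuotient T) where
  mul φ ψ := ⟨fun σ => φ.1 σ * ψ.1 σ, by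
    obtain ⟨_, a, rfl⟩ := φ
    obtain ⟨_, b, rfl⟩ := ψ
    exact ⟨a * b, funext fun σ => σ.1.map_mul' a b⟩⟩
  one := RealReducedQuotient.proj T 1
  zero := RealReducedQuotient.proj T 0
  neg φ := ⟨fun σ => -φ.1 σ, by
    obtain ⟨_, a, rfl⟩ := φ
    exact ⟨-a, funext fun σ => σ.1.map_neg' a⟩⟩
  mul_assoc φ ψ χ := Subtype.ext (funext fun σ => mul_assoc (φ.1 σ) (ψ.1 σ) (χ.1 σ))
  mul_comm φ ψ := Subtype.ext (funext fun σ => mul_comm (φ.1 σ) (ψ.1 σ))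
  one_mul φ := Subtype.ext (funext fun σ =>
    (congrArg (· * φ.1 σ) σ.1.map_one').trans (one_mul (φ.1 σ)))
  mul_one φ := Subtype.ext (funext fun σ =>
    (congrArg (φ.1 σ * ·) σ.1.map_one').trans (mul_one (φ.1 σ)))
  madd ψ χ := {φ | ∃ a b c : A, RealReducedQuotient.proj T a = φ ∧
    RealReducedQuotient.proj T b = ψ ∧ RealReducedQuotient.proj T c = χ ∧ a ∈ madd b c}

end RealReducedQuotient

section MarshallQuotient

theorem IsMultiring.neg_mul' {A : Type*} [PreMultiring A] [IsMultiring A] (a b : A) :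
    -a * b = -(a * b) := by
  have h1 : a ∈ madd 0 a := by
    rw [IsMultiring.madd_comm]
    exact (IsMultiring.mem_madd_zero a a).2 rfl
  have h0 : (0 : A) ∈ madd a (-a) := (IsMultiring.reversibility a 0 a h1).2
  have h2 := IsMultiring.half_distrib 0 a (-a) b h0
  rw [mul_comm 0 b, IsMultiring.mul_zero'] at h2
  exact (IsMultiring.mem_madd_zero _ _).1 (IsMultiring.reversibility _ _ _ h2).1

/-- Marshall equivalence modulo a multiplicative set `S`: `a ∼ b` if and only if `as = bt` for
some `s, t ∈ S`. It is a congruence for the product. -/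
def marshallCon {A : Type*} [PreMultiring A] (S : Submonoid A) : Con A where
  r a b := ∃ s ∈ S, ∃ t ∈ S, a * s = b * t
  iseqv :=
    { refl := fun _ => ⟨1, S.one_mem, 1, S.one_mem, rfl⟩
      symm := fun ⟨s, hs, t, ht, h⟩ => ⟨t, ht, s, hs, h.symm⟩
      trans := fun {a b c} ⟨s, hs, t, ht, h⟩ ⟨u, hu, v, hv, k⟩ =>
        ⟨s * u, S.mul_mem hs hu, v * t, S.mul_mem hv ht, by
          rw [← mul_assoc, h, mul_right_comm, k, mul_assoc]⟩ }
  mul' := fun {a b c d} ⟨s, hs, t, ht, h⟩ ⟨u, hu, v, hv, k⟩ =>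
    ⟨s * u, S.mul_mem hs hu, t * v, S.mul_mem ht hv, by
      rw [mul_mul_mul_comm, h, k, mul_mul_mul_comm]⟩

/-- The Marshall quotient `A /ₘ S`. -/
def MarshallQuotient {A : Type*} [PreMultiring A] (S : Submonoid A) : Type _ :=
  (marshallCon S).Quotient

/-- The canonical projection `A → A /ₘ S`. -/
def MarshallQuotient.proj {A : Type*} [PreMultiring A] (S : Submonoid A) (a : A) :
    MarshallQuotient S :=
  (a : (marshallCon S).Quotient)

/-- The product, minus and constants of `A /ₘ S` are induced by those of `A`; the class of `a` lies
in the sum of the classes of `b` and `c` if and only if `a' ∈ b' + c'` for some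
representatives. -/
instance MarshallQuotient.instPreMultiring {A : Type*} [PreMultiring A] [IsMultiring A]
    (S : Submonoid A) : PreMultiring (MarshallQuotient S) where
  __ := (inferInstance : CommMonoid (marshallCon S).Quotient)
  zero := MarshallQuotient.proj S 0
  neg := Quotient.map' (fun a => -a) (by
    rintro a b ⟨s, hs, t, ht, h⟩
    exact ⟨s, hs, t, ht, by
      rw [IsMultiring.neg_mul', IsMultiring.neg_mul', h]⟩)
  madd y z := {x | ∃ a b c : A, MarshallQuotient.proj S a = x ∧
    MarshallQuotient.proj S b = y ∧ MarshallQuotient.proj S c = z ∧ a ∈ madd b c}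

/-- The multiplicative set `1 + T = ⋃_{t ∈ T} (1 + t)` of a preorder `T`. -/
def onePlus {A : Type*} [PreMultiring A] [IsMultiring A] {T : Set A}
    (hT : IsMultiPreorder T) : Submonoid A where
  carrier := {x | ∃ t ∈ T, x ∈ madd 1 t}
  one_mem' := ⟨0, by
    have h := hT.sq_mem 0
    rwa [pow_two, IsMultiring.mul_zero'] at h, (IsMultiring.mem_madd_zero _ _).2 rfl⟩
  mul_mem' := by
    rintro x y ⟨t, ht, hx⟩ ⟨s, hs, hy⟩
    have h1 := IsMultiring.half_distrib _ _ _ y hx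
    have h2 := IsMultiring.half_distrib _ _ _ t hy
    rw [one_mul] at h1 h2
    rw [mul_comm y t] at h2
    have h3 : t * y ∈ T := hT.madd_subset _ ht _ (hT.mul_mem _ hs _ ht) h2
    obtain ⟨h, hh, hxy⟩ := IsMultiring.madd_assoc _ _ _ _ _ h1 hy
    exact ⟨h, hT.madd_subset _ hs _ h3 hh, hxy⟩

end MarshallQuotient

/-! `Q_T(A)` and the Marshall quotient are both quotients of `A`, with sums defined through
representatives. So everything reduces to one claim, `proj_onePlus_eq_proj_onePlus`: two elements
have the same sign at every order over `T` iff they agree modulo `1 + T`.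

Elements of `1 + T` have sign `1`, which gives one direction. The other rests on an abstract
Positivstellensatz: a maximal proper preorder is the nonnegative set of an order, so by Zorn a
preorder with no order over it contains `-1`. Applied to `T - aT`, this shows that an everywhere
positive `a` is equivalent to `1`. Regularity supplies an idempotent `e = ac` with `ae = a`, having
the same zeros as `a`. Together with `f ∈ 1 - e`, `fe = 0`, it allows `a` to be compared with `b` on
the support of `a` and off it separately.

The multiring laws of `Q_T(A)` are transported from the Marshall quotient. The real reduced
identities are checked in `3`, one order at a time. -/

namespace IsMultiring

/-! ### Arithmetic in multirings. -/

variable {A : Type*} [PreMultiring A] [IsMultiring A]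

theorem self_mem_zero_madd (a : A) : a ∈ madd 0 a := by
  rw [madd_comm]
  exact (mem_madd_zero a a).2 rfl

theorem mem_zero_madd {a b : A} : a ∈ madd 0 b ↔ a = b := by
  rw [madd_comm, mem_madd_zero]

theorem zero_mem_madd_neg (a : A) : (0 : A) ∈ madd a (-a) :=
  (reversibility a 0 a (self_mem_zero_madd a)).2

instance : HasDistribNeg A where
  neg_neg a := (mem_zero_madd.1 (reversibility _ _ _ (zero_mem_madd_neg a)).2).symm
  neg_mul := neg_mul'
  mul_neg a b := by rw [mul_comm, neg_mul', mul_comm]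

theorem zero_mul' (a : A) : 0 * a = 0 := by
  rw [mul_comm, mul_zero']

theorem neg_zero' : -(0 : A) = 0 :=
  (mem_zero_madd.1 (zero_mem_madd_neg (0 : A))).symm

theorem neg_mem_madd_neg {a b c : A} (h : a ∈ madd b c) : -a ∈ madd (-b) (-c) := by
  simpa using half_distrib a b c (-1) h

theorem left_distrib {a b c : A} (d : A) (h : a ∈ madd b c) : d * a ∈ madd (d * b) (d * c) := by
  simpa only [mul_comm d] using half_distrib a b c d h

theorem madd_assoc_rev {x h a b c : A} (hx : x ∈ madd a h) (hh : h ∈ madd b c) :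
    ∃ g ∈ madd a b, x ∈ madd g c := by
  rw [madd_comm] at hx hh
  obtain ⟨g, hg, hx⟩ := madd_assoc _ _ _ _ _ hx hh
  exact ⟨g, madd_comm b a ▸ hg, madd_comm c g ▸ hx⟩

theorem madd_madd_madd_comm {x y z a b c d : A} (hx : x ∈ madd a b) (hy : y ∈ madd c d)
    (hz : z ∈ madd x y) : ∃ u ∈ madd a c, ∃ v ∈ madd b d, z ∈ madd u v := by
  obtain ⟨h, hh, hz⟩ := madd_assoc _ _ _ _ _ hz hx
  rw [madd_comm] at hh
  obtain ⟨k, hk, hh⟩ := madd_assoc _ _ _ _ _ hh hy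
  obtain ⟨u, hu, hz⟩ := madd_assoc_rev hz hh
  exact ⟨u, hu, k, madd_comm d b ▸ hk, hz⟩

end IsMultiring

theorem SignType.mem_madd {x a b : SignType} :
    x ∈ madd a b ↔ (a = 0 ∧ x = b) ∨ (b = 0 ∧ x = a) ∨ (a = b ∧ x = a) ∨ (a ≠ 0 ∧ b = -a) :=
  Iff.rfl

open IsMultiring

/-! ### Preorders and the extension `T + aT`. -/

namespace IsMultiPreorder

variable {A : Type*} [PreMultiring A]

section Multiring

variable [IsMultiring A] {T : Set A}

theorem zero_mem (hT : IsMultiPreorder T) : (0 : A) ∈ T := by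
  simpa [pow_two, mul_zero'] using hT.sq_mem 0

omit [IsMultiring A] in
theorem one_mem (hT : IsMultiPreorder T) : (1 : A) ∈ T := by
  simpa using hT.sq_mem 1

theorem onePlus_subset (hT : IsMultiPreorder T) {x : A} (hx : x ∈ onePlus hT) : x ∈ T := by
  obtain ⟨t, ht, hx⟩ := hx
  exact hT.madd_subset _ hT.one_mem _ ht hx

theorem madd_mem_onePlus (hT : IsMultiPreorder T) {x s t : A} (hs : s ∈ onePlus hT) (ht : t ∈ T)
    (hx : x ∈ madd s t) : x ∈ onePlus hT := by
  obtain ⟨r, hr, hs⟩ := hs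
  obtain ⟨h, hh, hx⟩ := madd_assoc _ _ _ _ _ hx hs
  exact ⟨h, hT.madd_subset _ hr _ ht hh, hx⟩

theorem neg_one_mem (hT : IsMultiPreorder T) {x : A} (hx : x ∈ onePlus hT) (hx' : -x ∈ T) :
    (-1 : A) ∈ T := by
  obtain ⟨t, ht, hx⟩ := hx
  have h := neg_mem_madd_neg (reversibility _ _ _ hx).2
  rw [neg_neg] at h
  exact hT.madd_subset _ hx' _ ht h

end Multiring

/-- The preorder `T + aT` generated by a preorder `T` and an element `a` of a hyperring. -/
def adjoin (T : Set A) (a : A) : Set A :=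
  {x | ∃ s ∈ T, ∃ t ∈ T, x ∈ madd s (t * a)}

variable [IsHyperring A] {T : Set A}

theorem subset_adjoin (hT : IsMultiPreorder T) (a : A) : T ⊆ adjoin T a := fun x hx =>
  ⟨x, hx, 0, hT.zero_mem, by rw [zero_mul', mem_madd_zero]⟩

theorem mem_adjoin (hT : IsMultiPreorder T) (a : A) : a ∈ adjoin T a :=
  ⟨0, hT.zero_mem, 1, hT.one_mem, by rw [one_mul, mem_zero_madd]⟩

theorem isMultiPreorder_adjoin (hT : IsMultiPreorder T) (a : A) :
    IsMultiPreorder (adjoin T a) where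
  sq_mem x := hT.subset_adjoin a (hT.sq_mem x)
  mul_mem := by
    rintro x ⟨p, hp, q, hq, hx⟩ y ⟨r, hr, s, hs, hy⟩
    have h1 := left_distrib p hy
    have h2 := left_distrib (q * a) hy
    rw [madd_comm] at h2
    obtain ⟨u, hu, v, hv, h⟩ := madd_madd_madd_comm h1 h2 (half_distrib _ _ _ y hx)
    rw [← mul_assoc, mul_right_comm q a r] at hv
    -- Full distributivity is needed here: an element of `psa + qra` must again be a multiple `wa`
    -- with `w ∈ ps + qr`.
    obtain ⟨w, hw, rfl⟩ := IsHyperring.distrib _ _ _ _ hv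
    refine ⟨u, hT.madd_subset _ (hT.mul_mem _ hp _ hr) _ ?_ hu, w,
      hT.madd_subset _ (hT.mul_mem _ hp _ hs) _ (hT.mul_mem _ hq _ hr) hw, h⟩
    rw [mul_mul_mul_comm, ← pow_two]
    exact hT.mul_mem _ (hT.mul_mem _ hq _ hs) _ (hT.sq_mem a)
  madd_subset := by
    rintro x ⟨p, hp, q, hq, hx⟩ y ⟨r, hr, s, hs, hy⟩ z hz
    obtain ⟨u, hu, v, hv, h⟩ := madd_madd_madd_comm hx hy hz
    obtain ⟨w, hw, rfl⟩ := IsHyperring.distrib _ _ _ _ hv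
    exact ⟨u, hT.madd_subset _ hp _ hr hu, w, hT.madd_subset _ hq _ hs hw, h⟩

theorem exists_mul_mem_onePlus (hT : IsMultiPreorder T) {a : A} (h : (-1 : A) ∈ adjoin T a) :
    ∃ t ∈ T, -(t * a) ∈ onePlus hT := by
  obtain ⟨s, hs, t, ht, h⟩ := h
  have h := neg_mem_madd_neg (reversibility _ _ _ h).1
  rw [neg_neg, neg_neg, madd_comm] at h
  exact ⟨t, ht, s, hs, h⟩

end IsMultiPreorder

/-! ### Maximal proper preorders and the existence of orders. -/

namespace IsProperMultiPreorder

variable {A : Type*} [PreMultiring A]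

theorem sUnion_of_isChain {C : Set (Set A)} (hC : ∀ P ∈ C, IsProperMultiPreorder P)
    (hchain : IsChain (· ⊆ ·) C) (hne : C.Nonempty) : IsProperMultiPreorder (⋃₀ C) where
  sq_mem a := by
    obtain ⟨P, hP⟩ := hne
    exact ⟨P, hP, (hC P hP).sq_mem a⟩
  mul_mem := by
    rintro s ⟨P, hP, hs⟩ t ⟨Q, hQ, ht⟩
    rcases hchain.total hP hQ with h | h
    · exact ⟨Q, hQ, (hC Q hQ).mul_mem _ (h hs) _ ht⟩
    · exact ⟨P, hP, (hC P hP).mul_mem _ hs _ (h ht)⟩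
  madd_subset := by
    rintro s ⟨P, hP, hs⟩ t ⟨Q, hQ, ht⟩ x hx
    rcases hchain.total hP hQ with h | h
    · exact ⟨Q, hQ, (hC Q hQ).madd_subset _ (h hs) _ ht hx⟩
    · exact ⟨P, hP, (hC P hP).madd_subset _ hs _ (h ht) hx⟩
  neg_one_notMem := by
    rintro ⟨P, hP, h⟩
    exact (hC P hP).neg_one_notMem h

theorem exists_maximal {T : Set A} (hT : IsProperMultiPreorder T) :
    ∃ P, T ⊆ P ∧ Maximal IsProperMultiPreorder P :=
  zorn_subset_nonempty {P : Set A | IsProperMultiPreorder P}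
    (fun C hC hchain hne => ⟨⋃₀ C, sUnion_of_isChain hC hchain hne,
      fun _ => Set.subset_sUnion_of_mem⟩) T hT

variable [IsHyperring A] {P : Set A}

/-- By maximality `-1` lies in `P + aP` and in `P + bP`, so `-sa` and `-tb` lie in `1 + P` for some
`s, t ∈ P`, and so does their product `stab`. If `-ab` were in `P`, then `-stab ∈ P` would force `-1
∈ P`. This yields both `P ∪ -P = A` and the primality of `P ∩ -P`. -/
theorem neg_mul_notMem_of_maximal (hP : Maximal IsProperMultiPreorder P) {a b : A} (ha : a ∉ P)
    (hb : b ∉ P) : -(a * b) ∉ P := by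
  have hP' := hP.1.toIsMultiPreorder
  have key : ∀ c ∉ P, ∃ t ∈ P, -(t * c) ∈ onePlus hP' := by
    intro c hc
    refine hP'.exists_mul_mem_onePlus ?_
    by_contra h
    exact hc (hP.2 ⟨hP'.isMultiPreorder_adjoin c, h⟩ (hP'.subset_adjoin c) (hP'.mem_adjoin c))
  obtain ⟨s, hs, hsa⟩ := key a ha
  obtain ⟨t, ht, htb⟩ := key b hb
  intro h
  refine hP.1.neg_one_notMem (hP'.neg_one_mem (mul_mem hsa htb) ?_)
  rw [neg_mul_neg, mul_mul_mul_comm, ← mul_neg]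
  exact hP'.mul_mem _ (hP'.mul_mem _ hs _ ht) _ h

theorem mem_or_neg_mem_of_maximal (hP : Maximal IsProperMultiPreorder P) (a : A) :
    a ∈ P ∨ -a ∈ P := by
  by_contra! h
  have h' := neg_mul_notMem_of_maximal hP h.1 h.2
  rw [mul_neg, neg_neg, ← pow_two] at h'
  exact h' (hP.1.sq_mem a)

open Classical in
/-- The order attached to a maximal proper preorder. -/
noncomputable def homOfMaximal (hP : Maximal IsProperMultiPreorder P) :
    MultiringHom A SignType where
  toFun x := if x ∈ P then if -x ∈ P then 0 else 1 else -1
  map_madd' a b c h := by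
    -- Reversibility and negation rearrange `a ∈ b + c` in six ways. Closure of `P` under sums turns
    -- each into an implication, and together these exclude every sign pattern forbidden in `3`.
    have hs := hP.1.madd_subset
    have ha := mem_or_neg_mem_of_maximal hP a
    have hb := mem_or_neg_mem_of_maximal hP b
    have hc := mem_or_neg_mem_of_maximal hP c
    have h1 : b ∈ P → c ∈ P → a ∈ P := fun h1 h2 => hs _ h1 _ h2 h
    have h2 : -b ∈ P → -c ∈ P → -a ∈ P := fun h1 h2 => hs _ h1 _ h2 (neg_mem_madd_neg h)
    have h3 : -b ∈ P → a ∈ P → c ∈ P := fun h1 h2 => hs _ h1 _ h2 (reversibility _ _ _ h).1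
    have h4 : a ∈ P → -c ∈ P → b ∈ P := fun h1 h2 => hs _ h1 _ h2 (reversibility _ _ _ h).2
    have h5 : b ∈ P → -a ∈ P → -c ∈ P := fun h1 h2 => hs _ h1 _ h2 (by
      simpa using neg_mem_madd_neg (reversibility _ _ _ h).1)
    have h6 : -a ∈ P → c ∈ P → -b ∈ P := fun h1 h2 => hs _ h1 _ h2 (by
      simpa using neg_mem_madd_neg (reversibility _ _ _ h).2)
    rw [SignType.mem_madd]
    split_ifs <;> first | decide | grind
  map_mul' a b := by
    have hm := hP.1.mul_mem
    have ha := mem_or_neg_mem_of_maximal hP a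
    have hb := mem_or_neg_mem_of_maximal hP b
    have h1 : a ∈ P → b ∈ P → a * b ∈ P := fun h1 h2 => hm _ h1 _ h2
    have h2 : -a ∈ P → b ∈ P → -(a * b) ∈ P := fun h1 h2 => by simpa using hm _ h1 _ h2
    have h3 : a ∈ P → -b ∈ P → -(a * b) ∈ P := fun h1 h2 => by simpa using hm _ h1 _ h2
    have h4 : -a ∈ P → -b ∈ P → a * b ∈ P := fun h1 h2 => by simpa using hm _ h1 _ h2
    have n1 : a ∉ P → b ∉ P → -(a * b) ∉ P := neg_mul_notMem_of_maximal hP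
    have n2 : -a ∉ P → b ∉ P → a * b ∉ P := fun h1 h2 => by
      simpa using neg_mul_notMem_of_maximal hP h1 h2
    have n3 : a ∉ P → -b ∉ P → a * b ∉ P := fun h1 h2 => by
      simpa using neg_mul_notMem_of_maximal hP h1 h2
    have n4 : -a ∉ P → -b ∉ P → -(a * b) ∉ P := fun h1 h2 => by
      simpa using neg_mul_notMem_of_maximal hP h1 h2
    split_ifs <;> first | decide | grind
  map_zero' := by
    have h := hP.1.zero_mem
    rw [neg_zero', if_pos h, if_pos h]
  map_one' := by rw [if_pos hP.1.one_mem, if_neg hP.1.neg_one_notMem]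
  map_neg' a := by
    have ha := mem_or_neg_mem_of_maximal hP a
    rw [neg_neg]
    split_ifs <;> first | decide | grind

theorem nonempty_sperOver {T : Set A} (hT : IsProperMultiPreorder T) : Nonempty (SperOver T) := by
  obtain ⟨P, hTP, hP⟩ := hT.exists_maximal
  refine ⟨homOfMaximal hP, fun t ht => ?_⟩
  simp only [homOfMaximal, if_pos (hTP ht)]
  split_ifs <;> simp

end IsProperMultiPreorder

theorem IsMultiPreorder.neg_one_mem_of_isEmpty {A : Type*} [PreMultiring A] [IsHyperring A]
    {T : Set A} (hT : IsMultiPreorder T) (h : SperOver T → False) : (-1 : A) ∈ T := by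
  by_contra hn
  exact (IsProperMultiPreorder.nonempty_sperOver ⟨hT, hn⟩).elim h

/-- `0 ∈ e - e = 1·e + (-e)·e`, and full distributivity factors this `0` as `fe`. The element `f`
plays the role of the complementary idempotent. -/
theorem IsHyperring.exists_compl {A : Type*} [PreMultiring A] [IsHyperring A] {e : A}
    (he : e * e = e) : ∃ f ∈ madd 1 (-e), f * e = 0 := by
  have h := zero_mem_madd_neg (1 * e)
  nth_rw 2 [one_mul] at h
  nth_rw 2 [← he] at h
  rw [← neg_mul] at h
  obtain ⟨f, hf, h⟩ := IsHyperring.distrib _ _ _ _ h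
  exact ⟨f, hf, h.symm⟩

namespace SperOver

variable {A : Type*} [PreMultiring A] {T : Set A}

/-- An order over a set is an order over every smaller set. -/
def mono {T' : Set A} (h : T ⊆ T') (σ : SperOver T') : SperOver T :=
  ⟨σ.1, fun t ht => σ.2 t (h ht)⟩

theorem map_onePlus [IsMultiring A] (hT : IsMultiPreorder T) (σ : SperOver T) {s : A}
    (hs : s ∈ onePlus hT) : σ.1.toFun s = 1 := by
  obtain ⟨t, ht, hs⟩ := hs
  have h := σ.1.map_madd' _ _ _ hs
  rw [σ.1.map_one', SignType.mem_madd] at h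
  rcases σ.2 t ht with h' | h' <;> rw [h'] at h <;> revert h <;>
    generalize σ.1.toFun s = x <;> revert x <;> decide

end SperOver

/-! ### The Marshall quotient is a multiring. -/

namespace MarshallQuotient

variable {A : Type*} [PreMultiring A]

theorem proj_eq_proj {S : Submonoid A} {a b : A} :
    proj S a = proj S b ↔ ∃ s ∈ S, ∃ t ∈ S, a * s = b * t :=
  (marshallCon S).eq

theorem proj_surjective (S : Submonoid A) (x : MarshallQuotient S) : ∃ a, proj S a = x :=
  Quotient.exists_rep x

variable [IsMultiring A] {S : Submonoid A}

theorem proj_mul (a b : A) : proj S (a * b) = proj S a * proj S b := rfl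

instance : IsMultiring (MarshallQuotient S) where
  madd_nonempty x y := by
    obtain ⟨a, rfl⟩ := proj_surjective S x
    obtain ⟨b, rfl⟩ := proj_surjective S y
    obtain ⟨c, hc⟩ := madd_nonempty a b
    exact ⟨proj S c, c, a, b, rfl, rfl, rfl, hc⟩
  reversibility := by
    rintro _ _ _ ⟨a, b, c, rfl, rfl, rfl, h⟩
    obtain ⟨h1, h2⟩ := reversibility _ _ _ h
    exact ⟨⟨c, -b, a, rfl, rfl, rfl, h1⟩, ⟨b, a, -c, rfl, rfl, rfl, h2⟩⟩
  mem_madd_zero x y := by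
    constructor
    · rintro ⟨a, b, c, rfl, rfl, hc, h⟩
      obtain ⟨s, hs, t, -, hst⟩ := proj_eq_proj.1 hc
      have h := half_distrib _ _ _ s h
      rw [hst, zero_mul', mem_madd_zero] at h
      exact proj_eq_proj.2 ⟨s, hs, s, hs, h⟩
    · rintro rfl
      obtain ⟨a, rfl⟩ := proj_surjective S x
      exact ⟨a, a, 0, rfl, rfl, rfl, (mem_madd_zero a a).2 rfl⟩
  madd_assoc := by
    rintro _ _ _ _ _ ⟨x, g, c, rfl, rfl, rfl, hx⟩ ⟨g', a, b, hg, rfl, rfl, hg'⟩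
    -- The two representatives of the middle class satisfy `g's = gt`. Scaling the two relations by
    -- `s` and `t` gives them a common middle term without changing any class.
    obtain ⟨s, hs, t, ht, hst⟩ := proj_eq_proj.1 hg
    have hx := half_distrib _ _ _ t hx
    have hg' := half_distrib _ _ _ s hg'
    rw [hst] at hg'
    obtain ⟨h, hh, hxh⟩ := madd_assoc _ _ _ _ _ hx hg'
    have key : ∀ a, ∀ r ∈ S, proj S (a * r) = proj S a := fun a r hr =>
      proj_eq_proj.2 ⟨1, S.one_mem, r, hr, mul_one _⟩
    exact ⟨proj S h, ⟨h, _, _, rfl, key b s hs, key c t ht, hh⟩,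
      _, _, h, key x t ht, key a s hs, rfl, hxh⟩
  madd_comm x y := by
    ext z
    constructor <;>
    · rintro ⟨a, b, c, rfl, rfl, rfl, h⟩
      rw [madd_comm] at h
      exact ⟨a, c, b, rfl, rfl, rfl, h⟩
  mul_zero' x := by
    obtain ⟨a, rfl⟩ := proj_surjective S x
    exact congrArg (proj S) (mul_zero' a)
  half_distrib := by
    rintro _ _ _ w ⟨a, b, c, rfl, rfl, rfl, h⟩
    obtain ⟨d, rfl⟩ := proj_surjective S w
    exact ⟨a * d, b * d, c * d, rfl, rfl, rfl, half_distrib _ _ _ d h⟩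

end MarshallQuotient

/-! ### Signs at the orders over `T` versus classes modulo `1 + T`. -/

section Positivstellensatz

variable {A : Type*} [PreMultiring A] {T : Set A}

open MarshallQuotient

/-- An element which is positive at every order over `T` is equivalent to `1` modulo `1 + T`. -/
theorem proj_onePlus_eq_one [IsHyperring A] (hT : IsMultiPreorder T) {a : A}
    (ha : ∀ σ : SperOver T, σ.1.toFun a = 1) : proj (onePlus hT) a = 1 := by
  have h : (-1 : A) ∈ IsMultiPreorder.adjoin T (-a) := by
    refine (hT.isMultiPreorder_adjoin (-a)).neg_one_mem_of_isEmpty fun σ => ?_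
    have h1 := σ.2 _ (hT.mem_adjoin (-a))
    have h2 : σ.1.toFun a = 1 := ha (σ.mono (hT.subset_adjoin (-a)))
    rw [σ.1.map_neg', h2] at h1
    revert h1
    decide
  obtain ⟨t, ht, hs⟩ := hT.exists_mul_mem_onePlus h
  rw [mul_neg, neg_neg] at hs
  -- With `s = ta ∈ 1 + T`, any `x ∈ s + ts` lies in `1 + T`, and so does `ax ∈ ta² + s²`, because
  -- `s² ∈ 1 + T` and `ta² ∈ T`.
  obtain ⟨x, hx⟩ := madd_nonempty (t * a) (t * (t * a))
  have hx' := left_distrib a hx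
  refine proj_eq_proj.2 ⟨x, hT.madd_mem_onePlus hs (hT.mul_mem _ ht _ (hT.onePlus_subset hs)) hx,
    a * x, ?_, (one_mul _).symm⟩
  rw [madd_comm] at hx'
  refine hT.madd_mem_onePlus ?_ ?_ hx'
  · rw [← mul_assoc, mul_comm a t]
    exact mul_mem hs hs
  · rw [mul_left_comm, ← pow_two]
    exact hT.mul_mem _ ht _ (hT.sq_mem a)

/-- An idempotent which vanishes at every order over `T` is the negative of an element of `T`. -/
theorem neg_mem_of_forall_eq_zero [IsHyperring A] (hT : IsMultiPreorder T) {e : A}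
    (he : e * e = e) (h : ∀ σ : SperOver T, σ.1.toFun e = 0) : -e ∈ T := by
  have heT : e ∈ T := by simpa [pow_two, he] using hT.sq_mem e
  -- This preorder contains `T`, and also `-f` since `fe = 0`. An order over it has `σ(e) = 0`,
  -- hence `σ(f) = 1`, contradicting `σ(-f) ≥ 0`. So it contains `-1`, which means `-e ∈ T`.
  have hT' : IsMultiPreorder {x | x * e ∈ T} :=
    { sq_mem a := hT.mul_mem _ (hT.sq_mem a) _ heT
      mul_mem s hs t ht := by
        have h := hT.mul_mem _ hs _ ht
        rwa [mul_mul_mul_comm, he] at h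
      madd_subset s hs t ht x hx := hT.madd_subset _ hs _ ht (half_distrib _ _ _ e hx) }
  obtain ⟨f, hf, hfe⟩ := IsHyperring.exists_compl he
  have h1 : (-1 : A) ∈ {x | x * e ∈ T} := by
    refine hT'.neg_one_mem_of_isEmpty fun σ => ?_
    have h0 : σ.1.toFun e = 0 := h (σ.mono fun t ht => hT.mul_mem _ ht _ heT)
    have h1 : (-f) * e ∈ T := by
      rw [neg_mul, hfe, neg_zero']
      exact hT.zero_mem
    have h2 := σ.2 (-f) h1
    have h3 := σ.1.map_madd' _ _ _ hf
    rw [σ.1.map_neg', h0, σ.1.map_one', SignType.mem_madd] at h3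
    rw [σ.1.map_neg'] at h2
    revert h2 h3
    generalize σ.1.toFun f = x
    revert x
    decide
  simpa using h1

variable [IsVonNeumannHyperring A]

theorem exists_idempotent_mul_eq (a : A) : ∃ b : A, a * b * (a * b) = a * b ∧ a * (a * b) = a := by
  obtain ⟨b, hb⟩ := IsVonNeumannHyperring.regular a
  have h : a * (a * b) = a := by rw [← mul_assoc, ← pow_two, ← hb]
  exact ⟨b, by rw [mul_comm a b, mul_assoc, mul_comm b a, h, mul_comm], h⟩

/-- An element which vanishes at every order over `T` is annihilated by some element of `1 + T`. -/
theorem exists_mul_onePlus_eq_zero (hT : IsMultiPreorder T) {a : A}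
    (ha : ∀ σ : SperOver T, σ.1.toFun a = 0) : ∃ s ∈ onePlus hT, a * s = 0 := by
  obtain ⟨b, hb, hab⟩ := exists_idempotent_mul_eq a
  obtain ⟨f, hf, hfe⟩ := IsHyperring.exists_compl hb
  refine ⟨f, ⟨_, neg_mem_of_forall_eq_zero hT hb fun σ => ?_, hf⟩, ?_⟩
  · rw [σ.1.map_mul', ha, zero_mul]
  · rw [← hab, mul_assoc, mul_comm _ f, hfe, mul_zero']

/-- For `f ∈ 1 - e` with `fe = 0`, the product `af` vanishes at every order, so some `s ∈ 1 + T`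
kills it. Multiplying `1 ∈ f + e` by `as` leaves `as = aes`. -/
theorem proj_onePlus_mul_idempotent (hT : IsMultiPreorder T) {a e : A} (he : e * e = e)
    (h : ∀ σ : SperOver T, σ.1.toFun a ≠ 0 → σ.1.toFun e ≠ 0) :
    proj (onePlus hT) (a * e) = proj (onePlus hT) a := by
  obtain ⟨f, hf, hfe⟩ := IsHyperring.exists_compl he
  obtain ⟨s, hs, has⟩ := exists_mul_onePlus_eq_zero hT (a := a * f) fun σ => by
    have h0 := congrArg σ.1.toFun hfe
    rw [σ.1.map_mul', σ.1.map_zero', mul_eq_zero] at h0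
    rw [σ.1.map_mul', mul_eq_zero]
    have := h σ
    tauto
  have h1 := half_distrib _ _ _ s (left_distrib a (reversibility _ _ _ hf).2)
  rw [has, mem_zero_madd, neg_neg, mul_one] at h1
  exact proj_eq_proj.2 ⟨s, hs, s, hs, h1.symm⟩

/-- Any `u ∈ xe + f` is positive everywhere: it has the sign of `x` where `e` is nonzero and that of
`f`, namely `1`, elsewhere. So `u` is equivalent to `1`, while `ue = xe`. -/
theorem proj_onePlus_mul_of_pos (hT : IsMultiPreorder T) {x e : A} (he : e * e = e)
    (h : ∀ σ : SperOver T, σ.1.toFun e ≠ 0 → σ.1.toFun x = 1) :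
    proj (onePlus hT) (x * e) = proj (onePlus hT) e := by
  obtain ⟨f, hf, hfe⟩ := IsHyperring.exists_compl he
  obtain ⟨u, hu⟩ := madd_nonempty (x * e) f
  have hu1 : proj (onePlus hT) u = 1 := by
    refine proj_onePlus_eq_one hT fun σ => ?_
    have h1 := σ.1.map_madd' _ _ _ hf
    have h2 := σ.1.map_madd' _ _ _ hu
    have h3 := congrArg σ.1.toFun hfe
    have h4 := congrArg σ.1.toFun he
    have h5 := h σ
    rw [σ.1.map_neg', σ.1.map_one', SignType.mem_madd] at h1
    rw [σ.1.map_mul', SignType.mem_madd] at h2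
    rw [σ.1.map_mul', σ.1.map_zero'] at h3
    rw [σ.1.map_mul'] at h4
    have key : ∀ e f : SignType, e * e = e → f * e = 0 →
        ((1 : SignType) = 0 ∧ f = -e ∨ -e = 0 ∧ f = 1 ∨ 1 = -e ∧ f = 1 ∨
          (1 : SignType) ≠ 0 ∧ -e = -1) → e = 0 ∧ f = 1 ∨ e = 1 ∧ f = 0 := by
      decide
    rcases key _ _ h4 h3 h1 with ⟨he, hf⟩ | ⟨he, hf⟩
    · simpa [he, hf] using h2
    · rw [he] at h5
      simpa [he, hf, h5 one_ne_zero] using h2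
  have h1 := half_distrib _ _ _ e hu
  rw [hfe, mem_madd_zero, mul_assoc, he] at h1
  rw [← h1, proj_mul, hu1, one_mul]

/-- Elements with the same sign at every order over `T` are equivalent modulo `1 + T`. -/
theorem proj_onePlus_eq_proj_onePlus (hT : IsMultiPreorder T) {a b : A} :
    proj (onePlus hT) a = proj (onePlus hT) b ↔ evalHat T a = evalHat T b := by
  constructor
  · intro h
    obtain ⟨s, hs, t, ht, hst⟩ := proj_eq_proj.1 h
    funext σ
    have h := congrArg σ.1.toFun hst
    rwa [σ.1.map_mul', σ.1.map_mul', σ.map_onePlus hT hs, σ.map_onePlus hT ht, mul_one,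
      mul_one] at h
  · intro h
    have hab (σ : SperOver T) : σ.1.toFun a = σ.1.toFun b := congrFun h σ
    obtain ⟨c, hc, hac⟩ := exists_idempotent_mul_eq a
    have sign_mul_self : ∀ x : SignType, x ≠ 0 → x * x = 1 := by decide
    have ne_zero (σ : SperOver T) (hσ : σ.1.toFun (a * c) ≠ 0) : σ.1.toFun a ≠ 0 := by
      rw [σ.1.map_mul'] at hσ
      exact left_ne_zero_of_mul hσ
    have h1 := proj_onePlus_mul_of_pos hT (x := a * b) hc fun σ hσ => by
      rw [σ.1.map_mul', ← hab σ, sign_mul_self _ (ne_zero σ hσ)]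
    have h2 := proj_onePlus_mul_of_pos hT (x := a * a) hc fun σ hσ => by
      rw [σ.1.map_mul', sign_mul_self _ (ne_zero σ hσ)]
    have h3 := proj_onePlus_mul_idempotent hT (a := b) hc fun σ hσ h0 => hσ (by
      rw [← hab σ, ← hac, σ.1.map_mul', h0, mul_zero])
    -- With `e = ac`: `a = ae ∼ a(abe) = b(a²e) ∼ be ∼ b`.
    calc proj (onePlus hT) a = proj (onePlus hT) a * proj (onePlus hT) (a * c) := by
          rw [← proj_mul, hac]
      _ = proj (onePlus hT) (b * (a * a * (a * c))) := by
          rw [← h1, ← proj_mul]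
          congr 1
          ac_rfl
      _ = proj (onePlus hT) b := by rw [proj_mul, h2, ← proj_mul, h3]

end Positivstellensatz

/-! ### Transport of structure along isomorphisms. -/

namespace MultiringIso

variable {A B : Type*} [PreMultiring A] [PreMultiring B]

theorem ext_hom {Φ Ψ : MultiringIso A B} (h : ∀ a, Φ.hom.toFun a = Ψ.hom.toFun a) : Φ = Ψ := by
  have h' : ∀ b, Φ.inv.toFun b = Ψ.inv.toFun b := fun b => by
    rw [← Ψ.left_inv (Φ.inv.toFun b), ← h, Φ.right_inv]
  obtain ⟨⟨f, _, _, _, _, _⟩, ⟨g, _, _, _, _, _⟩, _, _⟩ := Φ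
  obtain ⟨⟨f', _, _, _, _, _⟩, ⟨g', _, _, _, _, _⟩, _, _⟩ := Ψ
  obtain rfl : f = f' := funext h
  obtain rfl : g = g' := funext h'
  rfl

theorem hom_mem_madd_iff (Φ : MultiringIso A B) {a b c : A} :
    Φ.hom.toFun a ∈ madd (Φ.hom.toFun b) (Φ.hom.toFun c) ↔ a ∈ madd b c :=
  ⟨fun h => by simpa only [Φ.left_inv] using Φ.inv.map_madd' _ _ _ h, Φ.hom.map_madd' _ _ _⟩

theorem isMultiring [IsMultiring B] (Φ : MultiringIso A B) : IsMultiring A where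
  madd_nonempty a b := by
    obtain ⟨c, hc⟩ := madd_nonempty (Φ.hom.toFun a) (Φ.hom.toFun b)
    exact ⟨Φ.inv.toFun c, by rwa [← Φ.hom_mem_madd_iff, Φ.right_inv]⟩
  reversibility a b c h := by
    simp only [← Φ.hom_mem_madd_iff, Φ.hom.map_neg'] at h ⊢
    exact reversibility _ _ _ h
  mem_madd_zero a b := by
    rw [← Φ.hom_mem_madd_iff, Φ.hom.map_zero', mem_madd_zero]
    exact ⟨fun h => by rw [← Φ.left_inv a, h, Φ.left_inv], congrArg _⟩
  madd_assoc x g a b c hx hg := by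
    rw [← Φ.hom_mem_madd_iff] at hx hg
    obtain ⟨h, hh, hxh⟩ := madd_assoc _ _ _ _ _ hx hg
    refine ⟨Φ.inv.toFun h, ?_, ?_⟩ <;> rwa [← Φ.hom_mem_madd_iff, Φ.right_inv]
  madd_comm a b := by
    ext x
    rw [← Φ.hom_mem_madd_iff, madd_comm, Φ.hom_mem_madd_iff]
  mul_zero' a := by
    rw [← Φ.left_inv (a * 0), Φ.hom.map_mul', Φ.hom.map_zero', mul_zero', Φ.inv.map_zero']
  half_distrib a b c d h := by
    rw [← Φ.hom_mem_madd_iff] at h ⊢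
    simp only [Φ.hom.map_mul']
    exact half_distrib _ _ _ _ h

end MultiringIso

/-! ### Real reducedness of `Q_T(A)` and the isomorphism. -/

namespace RealReducedQuotient

variable {A : Type*} [PreMultiring A] {T : Set A}

theorem proj_surjective (φ : RealReducedQuotient T) : ∃ a, proj T a = φ := by
  obtain ⟨_, a, rfl⟩ := φ
  exact ⟨a, rfl⟩

/-- Evaluation at an order, as a morphism `Q_T(A) → 3`. -/
def eval (σ : SperOver T) : MultiringHom (RealReducedQuotient T) SignType where
  toFun φ := φ.1 σ
  map_madd' := by
    rintro _ _ _ ⟨a, b, c, rfl, rfl, rfl, h⟩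
    exact σ.1.map_madd' _ _ _ h
  map_mul' _ _ := rfl
  map_zero' := σ.1.map_zero'
  map_one' := σ.1.map_one'
  map_neg' _ := rfl

theorem ext_eval {φ ψ : RealReducedQuotient T}
    (h : ∀ σ : SperOver T, (eval σ).toFun φ = (eval σ).toFun ψ) : φ = ψ :=
  Subtype.ext (funext h)

theorem eval_pow_two (σ : SperOver T) (φ : RealReducedQuotient T) :
    (eval σ).toFun (φ ^ 2) = (eval σ).toFun φ * (eval σ).toFun φ := by
  rw [pow_two, (eval σ).map_mul']

theorem eval_of_multiSumSq (σ : SperOver T) {φ : RealReducedQuotient T} (h : MultiSumSq φ) :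
    (eval σ).toFun φ ≠ -1 := by
  induction h with
  | sq a =>
    rw [eval_pow_two]
    generalize (eval σ).toFun a = x
    revert x
    decide
  | add a s x _ hx ih =>
    have h := (eval σ).map_madd' _ _ _ hx
    rw [eval_pow_two, SignType.mem_madd] at h
    revert h ih
    generalize (eval σ).toFun a = a
    generalize (eval σ).toFun s = s
    generalize (eval σ).toFun x = x
    revert a s x
    decide

/-- Evaluations at orders are morphisms to `3` and jointly separate points, so each identity follows
from a finite check in `3`. An order must exist for `-1` not to be a sum of squares. -/
theorem isRealReducedMultiring [IsMultiring (RealReducedQuotient T)] (hT : Nonempty (SperOver T)) :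
    IsRealReducedMultiring (RealReducedQuotient T) where
  semireal h := by
    obtain ⟨σ⟩ := hT
    refine eval_of_multiSumSq σ h ?_
    rw [(eval σ).map_neg', (eval σ).map_one']
  pow_three a := ext_eval fun σ => by
    rw [pow_succ, (eval σ).map_mul', eval_pow_two]
    generalize (eval σ).toFun a = x
    revert x
    decide
  madd_sq_mul a b := by
    refine (Set.Nonempty.subset_singleton_iff (madd_nonempty _ _)).1 fun x hx => ext_eval fun σ => ?_
    have h := (eval σ).map_madd' _ _ _ hx
    rw [(eval σ).map_mul', eval_pow_two, SignType.mem_madd] at h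
    revert h
    generalize (eval σ).toFun a = a
    generalize (eval σ).toFun b = b
    generalize (eval σ).toFun x = x
    revert a b x
    decide
  madd_sq_sq a b := by
    obtain ⟨x, hx⟩ := madd_nonempty (a ^ 2) (b ^ 2)
    refine ⟨x, hx, fun y hy => ext_eval fun σ => ?_⟩
    have h := (eval σ).map_madd' _ _ _ hx
    have h' := (eval σ).map_madd' _ _ _ hy
    rw [eval_pow_two, eval_pow_two, SignType.mem_madd] at h h'
    revert h h'
    generalize (eval σ).toFun a = a
    generalize (eval σ).toFun b = b
    generalize (eval σ).toFun x = x
    generalize (eval σ).toFun y = y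
    revert a b x y
    decide

variable [IsVonNeumannHyperring A]

theorem proj_eq_proj (hT : IsMultiPreorder T) {a b : A} : proj T a = proj T b ↔
    MarshallQuotient.proj (onePlus hT) a = MarshallQuotient.proj (onePlus hT) b := by
  rw [proj_onePlus_eq_proj_onePlus]
  exact Subtype.ext_iff

/-- The map from the Marshall quotient by `1 + T` to `Q_T(A)`. -/
def ofMarshallQuotient (hT : IsMultiPreorder T) :
    MultiringHom (MarshallQuotient (onePlus hT)) (RealReducedQuotient T) where
  toFun := Quotient.lift (proj T) fun _ _ h =>
    (proj_eq_proj hT).2 (MarshallQuotient.proj_eq_proj.2 h)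
  map_madd' := by
    rintro _ _ _ ⟨a, b, c, rfl, rfl, rfl, h⟩
    exact ⟨a, b, c, rfl, rfl, rfl, h⟩
  map_mul' x y := by
    obtain ⟨a, rfl⟩ := MarshallQuotient.proj_surjective _ x
    obtain ⟨b, rfl⟩ := MarshallQuotient.proj_surjective _ y
    exact Subtype.ext (funext fun σ => σ.1.map_mul' a b)
  map_zero' := rfl
  map_one' := rfl
  map_neg' x := by
    obtain ⟨a, rfl⟩ := MarshallQuotient.proj_surjective _ x
    exact Subtype.ext (funext fun σ => σ.1.map_neg' a)

/-- The map from `Q_T(A)` to the Marshall quotient by `1 + T`. -/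
noncomputable def toMarshallQuotientFun (hT : IsMultiPreorder T) (φ : RealReducedQuotient T) :
    MarshallQuotient (onePlus hT) :=
  MarshallQuotient.proj _ (proj_surjective φ).choose

theorem toMarshallQuotientFun_proj (hT : IsMultiPreorder T) (a : A) :
    toMarshallQuotientFun hT (proj T a) = MarshallQuotient.proj (onePlus hT) a :=
  (proj_eq_proj hT).1 (proj_surjective (proj T a)).choose_spec

/-- The isomorphism between `Q_T(A)` and the Marshall quotient by `1 + T`. -/
noncomputable def isoMarshallQuotient (hT : IsMultiPreorder T) :
    MultiringIso (RealReducedQuotient T) (MarshallQuotient (onePlus hT)) where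
  hom :=
    { toFun := toMarshallQuotientFun hT
      map_madd' := by
        rintro _ _ _ ⟨a, b, c, rfl, rfl, rfl, h⟩
        simp only [toMarshallQuotientFun_proj]
        exact ⟨a, b, c, rfl, rfl, rfl, h⟩
      map_mul' φ ψ := by
        obtain ⟨a, rfl⟩ := proj_surjective φ
        obtain ⟨b, rfl⟩ := proj_surjective ψ
        have h : proj T a * proj T b = proj T (a * b) :=
          Subtype.ext (funext fun σ => (σ.1.map_mul' a b).symm)
        rw [h]
        simp only [toMarshallQuotientFun_proj]
        rfl
      map_zero' := toMarshallQuotientFun_proj hT 0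
      map_one' := toMarshallQuotientFun_proj hT 1
      map_neg' φ := by
        obtain ⟨a, rfl⟩ := proj_surjective φ
        have h : -proj T a = proj T (-a) :=
          Subtype.ext (funext fun σ => (σ.1.map_neg' a).symm)
        rw [h]
        simp only [toMarshallQuotientFun_proj]
        rfl }
  inv := ofMarshallQuotient hT
  left_inv φ := (proj_surjective φ).choose_spec
  right_inv x := by
    obtain ⟨a, rfl⟩ := MarshallQuotient.proj_surjective _ x
    exact toMarshallQuotientFun_proj hT a

end RealReducedQuotient

theorem mainTheorem4 {A : Type*} [PreMultiring A] [IsVonNeumannHyperring A]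
    (T : Set A) (hT : IsProperMultiPreorder T) :
    IsRealReducedMultiring (RealReducedQuotient T) ∧
      ∃! Φ : MultiringIso (RealReducedQuotient T) (MarshallQuotient (onePlus hT.toIsMultiPreorder)),
        ∀ a : A, Φ.hom.toFun (RealReducedQuotient.proj T a) =
          MarshallQuotient.proj (onePlus hT.toIsMultiPreorder) a := by
  have hT' := hT.toIsMultiPreorder
  -- The isomorphism is built from the operations alone, so it can supply the multiring laws of
  -- `Q_T(A)`.
  have := (RealReducedQuotient.isoMarshallQuotient hT').isMultiring
  refine ⟨RealReducedQuotient.isRealReducedMultiring hT.nonempty_sperOver,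
    RealReducedQuotient.isoMarshallQuotient hT',
    RealReducedQuotient.toMarshallQuotientFun_proj hT', fun Φ hΦ => ?_⟩
  refine MultiringIso.ext_hom fun φ => ?_
  obtain ⟨a, rfl⟩ := RealReducedQuotient.proj_surjective φ
  exact (hΦ a).trans (RealReducedQuotient.toMarshallQuotientFun_proj hT' a).symm
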